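/- All formal group laws are one-dimensional and commutative. A homomorphism $(f,\alpha)\colon (F_1,R_1)\to(F_2,R_2)$ between formal group laws $F_1$ over $R_1$ and $F_2$ over $R_2$ is a pair consisting of a ring homomorphism $\alpha\colon R_2\to R_1$ and a homomorphism $f\colon F_1\to\alpha^*F_2$ of formal group laws over $R_1$ in the usual sense; composition is $(g,\beta)\circ(f,\alpha)=(\alpha^*g\circ f,\ \alpha\circ\beta)$, the identity is $(X,\mathrm{id})$, and an isomorphism is a homomorphism with a two-sided inverse. Let $R$ be a complete Noetherian local ring with residue field $k$ of characteristic $p>0$, and let $G$ be a formal group law over $k$. For a complete Noetherian local $R$-algebra $A$ (with local structure map) with maximal ideal $\mathfrak m$, projection $\pi\colon A\to A/\mathfrak m$ and induced inclusion $\iota\colon k\to A/\mathfrak m$, a deformation of $G$ to $A$ is a formal group law $\widetilde G$ over $A$ with $\iota^*G=\pi^*\widetilde G$. Two formal group laws over $A$ are $*$-isomorphic if there is an isomorphism $u$ between them over $A$ with $\pi^*u=X$. A deformation $\widetilde G$ of $G$ to $R[[t_1,\dots,t_m]]$ is universal if for every such $A$ and every deformation $G'$ of $G$ to $A$ there is a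 unique local $R$-algebra homomorphism $\alpha\colon R[[t_1,\dots,t_m]]\to A$ such that $\alpha^*\widetilde G$ is $*$-isomorphic to $G'$. **Lemma.** Let $F$ and $G$ be formal group laws of the same finite height $n$ over $k$, and let $(\bar f,\bar\alpha)\colon (F,k)\to(G,k)$ be an isomorphism. Let $\alpha$ be a ring automorphism of $R$ that induces $\bar\alpha$ on the residue field $k$. Let $\widetilde F$ be a universal deformation of $F$ over $R[[u_1,\dots,u_{n-1}]]$ and $\widetilde G$ a universal deformation of $G$ over $R[[w_1,\dots,w_{n-1}]]$. Then there is a unique isomorphism $$(g,\beta)\colon (\widetilde F,R[[u_1,\dots,u_{n-1}]])\to(\widetilde G,R[[w_1,\dots,w_{n-1}]])$$ that induces $(\bar f,\bar\alpha)$ on the residue fields and satisfies $i\circ\alpha=\beta\circ j$, where $i\colon R\to R[[u_1,\dots,u_{n-1}]]$ and $j\colon R\to R[[w_1,\dots,w_{n-1}]]$ are the canonical inclusions. -/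

import Mathlib

open IsLocalRing

noncomputable section

namespace FormalGroup

section Homs

variable {R : Type*} [CommRing R]

/-- `F.IsHom G f`: the power series `f` without constant term is a homomorphism `F → G` of
formal group laws over `R` in the usual sense, `f(F(X, Y)) = G(f(X), f(Y))`. -/
structure IsHom (F G : FormalGroup R) (f : PowerSeries R) : Prop where
  constantCoeff_eq_zero : PowerSeries.constantCoeff f = 0
  subst_eq : PowerSeries.subst F.toPowerSeries f =
    G.toPowerSeries.subst ![
      PowerSeries.subst (MvPowerSeries.X 0 : MvPowerSeries (Fin 2) R) f,
      PowerSeries.subst (MvPowerSeries.X 1 : MvPowerSeries (Fin 2) R) f]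

/-- `F.IsIsom G f`: `f` is an isomorphism `F → G` of formal group laws over `R` in the usual
sense, that is, a homomorphism with a two-sided inverse under composition of power series. -/
def IsIsom (F G : FormalGroup R) (f : PowerSeries R) : Prop :=
  F.IsHom G f ∧ ∃ g : PowerSeries R, G.IsHom F g ∧
    PowerSeries.subst f g = PowerSeries.X ∧ PowerSeries.subst g f = PowerSeries.X

/-- The multiplication-by-`m` series: `[0]_F(X) = 0` and `[m + 1]_F(X) = F([m]_F(X), X)`. -/
def mulSeries (F : FormalGroup R) : ℕ → PowerSeries R
  | 0 => 0
  | m + 1 => F.toPowerSeries.subst ![mulSeries F m, PowerSeries.X]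

/-- `F` has (finite) height `n` at `p`: `[p]_F(X) = g(X ^ (p ^ n))` with `g'(0) ≠ 0`. -/
def HasHeight (F : FormalGroup R) (p n : ℕ) : Prop :=
  ∃ g : PowerSeries R, PowerSeries.coeff 1 g ≠ 0 ∧
    F.mulSeries p = PowerSeries.subst (PowerSeries.X ^ (p ^ n) : PowerSeries R) g

lemma IsHom.hasSubst {F G : FormalGroup R} {f : PowerSeries R} (h : F.IsHom G f) :
    PowerSeries.HasSubst f :=
  PowerSeries.HasSubst.of_constantCoeff_zero' h.constantCoeff_eq_zero

lemma hasSubst_toPowerSeries (F : FormalGroup R) : PowerSeries.HasSubst F.toPowerSeries :=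
  PowerSeries.HasSubst.of_constantCoeff_zero F.zero_constantCoeff

lemma hasSubst_pair {f : PowerSeries R} (hf : PowerSeries.constantCoeff f = 0) :
    MvPowerSeries.HasSubst ![
      PowerSeries.subst (MvPowerSeries.X 0 : MvPowerSeries (Fin 2) R) f,
      PowerSeries.subst (MvPowerSeries.X 1 : MvPowerSeries (Fin 2) R) f] := by
  refine MvPowerSeries.hasSubst_of_constantCoeff_zero fun i => ?_
  fin_cases i
  · exact PowerSeries.constantCoeff_subst_eq_zero (by simp) f hf
  · exact PowerSeries.constantCoeff_subst_eq_zero (by simp) f hf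

lemma isHom_id (F : FormalGroup R) : F.IsHom F PowerSeries.X where
  constantCoeff_eq_zero := by simp
  subst_eq := by
    rw [PowerSeries.subst_X F.hasSubst_toPowerSeries, PowerSeries.subst_X (.X 0),
      PowerSeries.subst_X (.X 1)]
    have h : (![MvPowerSeries.X 0, MvPowerSeries.X 1] : Fin 2 → MvPowerSeries (Fin 2) R) =
        MvPowerSeries.X := by
      ext1 i; fin_cases i <;> rfl
    rw [h, MvPowerSeries.subst_self]; rfl

lemma IsHom.comp {F G H : FormalGroup R} {f g : PowerSeries R} (hg : G.IsHom H g)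
    (hf : F.IsHom G f) : F.IsHom H (PowerSeries.subst f g) where
  constantCoeff_eq_zero :=
    PowerSeries.constantCoeff_subst_eq_zero hf.constantCoeff_eq_zero g hg.constantCoeff_eq_zero
  subst_eq := by
    have hv := hasSubst_pair hf.constantCoeff_eq_zero
    rw [PowerSeries.subst_comp_subst_apply hf.hasSubst F.hasSubst_toPowerSeries, hf.subst_eq,
      PowerSeries.subst_comp_subst_apply hf.hasSubst (.X 0),
      PowerSeries.subst_comp_subst_apply hf.hasSubst (.X 1)]
    have h1 := congrArg (MvPowerSeries.subst ![
      PowerSeries.subst (MvPowerSeries.X 0 : MvPowerSeries (Fin 2) R) f,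
      PowerSeries.subst (MvPowerSeries.X 1 : MvPowerSeries (Fin 2) R) f]) hg.subst_eq
    rw [MvPowerSeries.subst_comp_subst_apply (hasSubst_pair hg.constantCoeff_eq_zero) hv] at h1
    unfold PowerSeries.subst at h1 hv ⊢
    erw [MvPowerSeries.subst_comp_subst_apply G.hasSubst_toPowerSeries.const hv] at h1
    rw [h1]
    congr 1
    ext1 i
    fin_cases i
    · simp only [Fin.zero_eta, Matrix.cons_val_zero]
      rw [MvPowerSeries.subst_comp_subst_apply (PowerSeries.HasSubst.X 0).const hv]
      simp [MvPowerSeries.subst_X hv]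
    · simp only [Fin.mk_one, Matrix.cons_val_one, Matrix.cons_val_fin_one]
      rw [MvPowerSeries.subst_comp_subst_apply (PowerSeries.HasSubst.X 1).const hv]
      simp [MvPowerSeries.subst_X hv]

lemma IsHom.map {S : Type*} [CommRing S] {F G : FormalGroup R} {f : PowerSeries R}
    (hf : F.IsHom G f) (α : R →+* S) : (F.map α).IsHom (G.map α) (PowerSeries.map α f) where
  constantCoeff_eq_zero := by
    have := hf.constantCoeff_eq_zero
    rw [← PowerSeries.coeff_zero_eq_constantCoeff_apply] at this ⊢
    rw [PowerSeries.coeff_map, this, map_zero]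
  subst_eq := by
    have h := congrArg (MvPowerSeries.map α) hf.subst_eq
    rw [PowerSeries.map_subst F.hasSubst_toPowerSeries,
      MvPowerSeries.map_subst (hasSubst_pair hf.constantCoeff_eq_zero)] at h
    rw [map_toPowerSeries, map_toPowerSeries, h]
    congr 1
    ext1 i
    fin_cases i
    · simp [PowerSeries.map_subst (PowerSeries.HasSubst.X (0 : Fin 2))]
    · simp [PowerSeries.map_subst (PowerSeries.HasSubst.X (1 : Fin 2))]

end Homs

end FormalGroup

/-- A homomorphism `(f, α) : (F₁, R₁) → (F₂, R₂)` between formal group laws over possibly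
different rings: a ring homomorphism `α : R₂ → R₁` together with a homomorphism
`f : F₁ → α^* F₂` over `R₁`. -/
@[ext]
structure FGLHom {R₁ R₂ : Type*} [CommRing R₁] [CommRing R₂]
    (F₁ : FormalGroup R₁) (F₂ : FormalGroup R₂) where
  series : PowerSeries R₁
  ringHom : R₂ →+* R₁
  isHom : F₁.IsHom (F₂.map ringHom) series

namespace FGLHom

variable {R₁ R₂ R₃ : Type*} [CommRing R₁] [CommRing R₂] [CommRing R₃]

/-- The identity `(X, id)`. -/
def id (F : FormalGroup R₁) : FGLHom F F where
  series := PowerSeries.X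
  ringHom := RingHom.id R₁
  isHom := by
    have h : F.map (RingHom.id R₁) = F := by
      ext1
      simp [MvPowerSeries.map_id]
    rw [h]
    exact F.isHom_id

/-- The composite `(g, β) ∘ (f, α) = (α^* g ∘ f, α ∘ β)`. -/
def comp {F₁ : FormalGroup R₁} {F₂ : FormalGroup R₂} {F₃ : FormalGroup R₃}
    (ψ : FGLHom F₂ F₃) (φ : FGLHom F₁ F₂) : FGLHom F₁ F₃ where
  series := PowerSeries.subst φ.series (PowerSeries.map φ.ringHom ψ.series)
  ringHom := φ.ringHom.comp ψ.ringHom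
  isHom := by
    have h : F₃.map (φ.ringHom.comp ψ.ringHom) = (F₃.map ψ.ringHom).map φ.ringHom := by
      ext1
      simp [MvPowerSeries.map_map]
    rw [h]
    exact (ψ.isHom.map φ.ringHom).comp φ.isHom

/-- `(f, α)` is an isomorphism if it has a two-sided inverse. -/
def IsIso {F₁ : FormalGroup R₁} {F₂ : FormalGroup R₂} (φ : FGLHom F₁ F₂) : Prop :=
  ∃ ψ : FGLHom F₂ F₁, φ.comp ψ = FGLHom.id F₂ ∧ ψ.comp φ = FGLHom.id F₁

end FGLHom

section Deformations

instance MvPowerSeries.isLocalHom_algebraMap_self {σ R : Type*} [CommRing R] :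
    IsLocalHom (algebraMap R (MvPowerSeries σ R)) where
  map_nonunit a h := by
    have h' := h.map (MvPowerSeries.constantCoeff (σ := σ) (R := R))
    simpa [MvPowerSeries.algebraMap_apply] using h'

variable {R : Type*} [CommRing R] [IsLocalRing R]

/-- `Gt` is a deformation to the local `R`-algebra `A` of the formal group law `G` over the residue
field `k` of `R`: it is a commutative formal group law over `A` with `ι^* G = π^* Gt`, where
`ι : k → A / 𝔪` is the induced inclusion of residue fields and `π : A → A / 𝔪`. -/
structure IsDeformation {A : Type*} [CommRing A] [IsLocalRing A] [Algebra R A]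
    [IsLocalHom (algebraMap R A)] (G : FormalGroup (ResidueField R)) (Gt : FormalGroup A) :
    Prop where
  isComm : Gt.IsComm
  map_eq : G.map (ResidueField.map (algebraMap R A)) = Gt.map (residue A)

/-- `G₁` and `G₂` are `*`-isomorphic: there is an isomorphism `u : G₁ → G₂` over `A` reducing to
the identity series `X` over the residue field of `A`. -/
def StarIsomorphic {A : Type*} [CommRing A] [IsLocalRing A] (G₁ G₂ : FormalGroup A) : Prop :=
  ∃ u : PowerSeries A, G₁.IsIsom G₂ u ∧ PowerSeries.map (residue A) u = PowerSeries.X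

end Deformations

/-- `Gt` is a universal deformation of `G` over the power series ring `R⟦t_i⟧`: it is a deformation
of `G`, and for every complete Noetherian local `R`-algebra `A` (with local structure map) and
every deformation `G'` of `G` to `A` there is a unique local `R`-algebra homomorphism
`α : R⟦t_i⟧ → A` such that `α^* Gt` is `*`-isomorphic to `G'`. -/
structure IsUniversalDeformation.{u} {R : Type u} [CommRing R] [IsLocalRing R] {m : ℕ}
    (G : FormalGroup (ResidueField R)) (Gt : FormalGroup (MvPowerSeries (Fin m) R)) : Prop where
  isDeformation : IsDeformation G Gt
  existsUnique : ∀ (A : Type u) [CommRing A] [IsLocalRing A] [IsNoetherianRing A]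
    [IsAdicComplete (maximalIdeal A) A] [Algebra R A] [IsLocalHom (algebraMap R A)]
    (G' : FormalGroup A), IsDeformation G G' →
    ∃! α : MvPowerSeries (Fin m) R →ₐ[R] A,
      IsLocalHom (α : MvPowerSeries (Fin m) R →+* A) ∧
        StarIsomorphic (Gt.map (α : MvPowerSeries (Fin m) R →+* A)) G'

/-- Let `A` and `B` be local `R`-algebras, and `Ft`, `Gt` formal group laws over `A` and `B`.
A homomorphism `(g, β) : (Ft, A) → (Gt, B)` induces `(f, a) : (F, k) → (G, k)` on residue fields:
`β` is local, the map of residue fields `B / 𝔪_B → A / 𝔪_A` given by `β` restricts to `a` on `k`,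
and the reduction of `g` is `f`. -/
def FGLHom.InducesOnResidueField {R A B : Type*} [CommRing R] [IsLocalRing R]
    [CommRing A] [IsLocalRing A] [Algebra R A] [IsLocalHom (algebraMap R A)]
    [CommRing B] [IsLocalRing B] [Algebra R B] [IsLocalHom (algebraMap R B)]
    {Ft : FormalGroup A} {Gt : FormalGroup B} {F G : FormalGroup (ResidueField R)}
    (φ : FGLHom Ft Gt) (φ₀ : FGLHom F G) : Prop :=
  ∃ _ : IsLocalHom φ.ringHom,
    (ResidueField.map φ.ringHom).comp (ResidueField.map (algebraMap R B)) =
      (ResidueField.map (algebraMap R A)).comp φ₀.ringHom ∧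
    PowerSeries.map (residue A) φ.series =
      PowerSeries.map (ResidueField.map (algebraMap R A)) φ₀.series

end

/-!
Existence: lift `f̄` coefficientwise to a change of coordinates `f` of `F̃`. In the coordinate `f`,
the formal group law `F̃` becomes a deformation `G'` of `G` along `i ∘ α`, so universality of `G̃`
yields `β` and a `*`-isomorphism `v : G' → β^* G̃`; the lift is `(v ∘ f, β)`.

Uniqueness: if `(f₁, β₁)` and `(f₂, β₂)` are two lifts, then `f₂ ∘ f₁⁻¹` is a `*`-isomorphism
`β₁^* G̃ → β₂^* G̃`, so `β₁ = β₂` by universality. Homomorphisms `f₁` and `f₂` with the same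
reduction then agree by rigidity: they commute with multiplication by `p`, whose reduction is a
nonzero power series in `X ^ p`, so a congruence `f₁ ≡ f₂` modulo an ideal `I ⊆ 𝔪` gives
`[p] ∘ f₁ ≡ [p] ∘ f₂` modulo `I 𝔪`, that is `f₁ ∘ [p] ≡ f₂ ∘ [p]`, which forces `f₁ ≡ f₂` modulo
`I 𝔪`; now iterate.

A lift of an isomorphism is an isomorphism, because it is inverse to any lift of the inverse:
both composites are lifts of the identity.
-/

noncomputable section

namespace LubinTate

section AdicCompleteness

open PowerSeries

variable {A : Type*} [CommRing A]

lemma sModEq_pow_smul_top_iff {I : Ideal A} {n : ℕ} {a b : A} :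
    a ≡ b [SMOD (I ^ n • ⊤ : Submodule A A)] ↔ a - b ∈ I ^ n := by
  rw [SModEq.sub_mem, smul_eq_mul, Ideal.mul_top]

lemma coeff_mem_pow_of_mem_comap_constantCoeff_pow {I : Ideal A} {n : ℕ} {f : PowerSeries A}
    (hf : f ∈ I.comap constantCoeff ^ n) (i : ℕ) : coeff i f ∈ I ^ (n - i) := by
  induction n generalizing f i with
  | zero => simp
  | succ n ih =>
    rw [pow_succ] at hf
    refine Submodule.mul_induction_on hf (fun a ha b hb => ?_) fun a b ha hb => ?_
    · rw [coeff_mul]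
      refine Ideal.sum_mem _ fun ⟨j, l⟩ hjl => ?_
      have hjl : j + l = i := Finset.HasAntidiagonal.mem_antidiagonal.mp hjl
      have hb' : coeff l b ∈ I ^ (1 - l) := by
        rcases l with _ | l
        · simpa using hb
        · simp
      refine Ideal.pow_le_pow_right (n := n - j + (1 - l)) (by omega) ?_
      rw [pow_add]
      exact Ideal.mul_mem_mul (ih ha j) hb'
    · rw [map_add]
      exact add_mem ha hb

lemma mem_comap_constantCoeff_pow_of_coeff_mem_pow {I : Ideal A} {n : ℕ} {f : PowerSeries A}
    (hf : ∀ i, coeff i f ∈ I ^ (n - i)) : f ∈ I.comap constantCoeff ^ n := by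
  have hX : (X : PowerSeries A) ∈ I.comap constantCoeff := by simp
  have hC : I.map C ≤ I.comap (constantCoeff (R := A)) :=
    Ideal.map_le_iff_le_comap.mpr fun a ha => by simpa using ha
  have htrunc : (trunc n f : PowerSeries A) = ∑ i ∈ Finset.range n, C (coeff i f) * X ^ i := by
    rw [trunc_apply, Nat.Ico_zero_eq_range, ← Polynomial.coeToPowerSeries.ringHom_apply, map_sum]
    simp [monomial_eq_C_mul_X_pow]
  rw [eq_X_pow_mul_shift_add_trunc n f, htrunc]
  refine add_mem (Ideal.mul_mem_right _ _ (Ideal.pow_mem_pow hX n)) (Ideal.sum_mem _ fun i hi => ?_)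
  have hCi : C (coeff i f) ∈ I.comap (constantCoeff (R := A)) ^ (n - i) :=
    Ideal.pow_right_mono hC _ (Ideal.map_pow (C : A →+* _) I _ ▸ Ideal.mem_map_of_mem C (hf i))
  rw [← Nat.sub_add_cancel (Finset.mem_range.mp hi).le, pow_add]
  exact Ideal.mul_mem_mul hCi (Ideal.pow_mem_pow hX i)

lemma mem_comap_constantCoeff_pow_iff {I : Ideal A} {n : ℕ} {f : PowerSeries A} :
    f ∈ I.comap constantCoeff ^ n ↔ ∀ i, coeff i f ∈ I ^ (n - i) :=
  ⟨coeff_mem_pow_of_mem_comap_constantCoeff_pow, mem_comap_constantCoeff_pow_of_coeff_mem_pow⟩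

lemma isHausdorff_comap_constantCoeff (I : Ideal A) [IsHausdorff I A] :
    IsHausdorff (I.comap constantCoeff) (PowerSeries A) where
  haus' f hf := by
    ext i
    refine IsHausdorff.haus (I := I) inferInstance _ fun n => ?_
    have h := sModEq_pow_smul_top_iff.mp (hf (n + i))
    rw [sub_zero, mem_comap_constantCoeff_pow_iff] at h
    rw [sModEq_pow_smul_top_iff, sub_zero]
    simpa using h i

lemma isPrecomplete_comap_constantCoeff (I : Ideal A) [IsPrecomplete I A] :
    IsPrecomplete (I.comap constantCoeff) (PowerSeries A) where
  prec' f hf := by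
    have hcoeff {a b : ℕ} (hab : a ≤ b) (i : ℕ) : coeff i (f a) - coeff i (f b) ∈ I ^ (a - i) := by
      rw [← map_sub]
      exact mem_comap_constantCoeff_pow_iff.mp (sModEq_pow_smul_top_iff.mp (hf hab)) i
    have hlim (i : ℕ) : ∃ l : A, ∀ n, coeff i (f (n + i)) - l ∈ I ^ n := by
      simp only [← sModEq_pow_smul_top_iff]
      refine IsPrecomplete.prec (I := I) inferInstance fun {a b} hab => ?_
      simpa using sModEq_pow_smul_top_iff.mpr (hcoeff (Nat.add_le_add_right hab i) i)
    choose l hl using hlim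
    refine ⟨mk l, fun n => sModEq_pow_smul_top_iff.mpr <|
      mem_comap_constantCoeff_pow_iff.mpr fun i => ?_⟩
    rw [map_sub, coeff_mk]
    simpa using add_mem (hcoeff (show n ≤ n - i + i by omega) i) (hl i (n - i))

lemma isAdicComplete_maximalIdeal_powerSeries [IsLocalRing A] [IsAdicComplete (maximalIdeal A) A] :
    IsAdicComplete (maximalIdeal (PowerSeries A)) (PowerSeries A) := by
  have : IsLocalHom (constantCoeff (R := A)) :=
    ⟨fun _ h => isUnit_iff_constantCoeff.mpr h⟩
  rw [← maximalIdeal_comap (constantCoeff (R := A))]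
  exact { isHausdorff_comap_constantCoeff _, isPrecomplete_comap_constantCoeff _ with }

lemma isAdicComplete_maximalIdeal_of_ringEquiv {B : Type*} [CommRing B] [IsLocalRing A]
    [IsLocalRing B] (e : A ≃+* B) [IsAdicComplete (maximalIdeal A) A] :
    IsAdicComplete (maximalIdeal B) B := by
  have : ((maximalIdeal A).map e).IsMaximal := Ideal.map_isMaximal_of_equiv e
  rw [← eq_maximalIdeal this, IsAdicComplete.congr_ringEquiv]
  infer_instance

theorem isAdicComplete_maximalIdeal_mvPowerSeries [IsLocalRing A]
    [IsAdicComplete (maximalIdeal A) A] (m : ℕ) :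
    IsAdicComplete (maximalIdeal (MvPowerSeries (Fin m) A)) (MvPowerSeries (Fin m) A) := by
  induction m with
  | zero =>
    exact isAdicComplete_maximalIdeal_of_ringEquiv
      (MvPowerSeries.isEmptyEquiv (Fin 0) A).toRingEquiv.symm
  | succ m ih =>
    have := isAdicComplete_maximalIdeal_powerSeries (A := MvPowerSeries (Fin m) A)
    exact isAdicComplete_maximalIdeal_of_ringEquiv
      (MvPowerSeries.finSuccEquiv A m).toRingEquiv.symm

end AdicCompleteness

section Substitution

variable {A : Type*} [CommRing A]

lemma map_subst_powerSeries {B : Type*} [CommRing B] (π : A →+* B) {f : PowerSeries A}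
    (hf : PowerSeries.HasSubst f) (g : PowerSeries A) :
    PowerSeries.map π (PowerSeries.subst f g) =
      PowerSeries.subst (PowerSeries.map π f) (PowerSeries.map π g) :=
  PowerSeries.map_subst hf g

lemma coeff_one_subst {f : PowerSeries A} (hf : PowerSeries.constantCoeff f = 0)
    (g : PowerSeries A) :
    PowerSeries.coeff 1 (PowerSeries.subst f g) =
      PowerSeries.coeff 1 g * PowerSeries.coeff 1 f := by
  rw [PowerSeries.coeff_subst' (.of_constantCoeff_zero' hf), finsum_eq_single _ 1]
  · simp
  · rintro (_ | _ | d) hd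
    · simp [PowerSeries.coeff_one]
    · simp at hd
    · obtain ⟨h, rfl⟩ := PowerSeries.X_dvd_iff.mpr hf
      rw [mul_pow, PowerSeries.coeff_X_pow_mul', if_neg (by omega), smul_zero]

lemma hasSubst_subst {σ : Type*} {f : PowerSeries A} (hf : PowerSeries.constantCoeff f = 0)
    {a : MvPowerSeries σ A} (ha : PowerSeries.HasSubst a) :
    PowerSeries.HasSubst (PowerSeries.subst a f) :=
  MvPowerSeries.IsNilpotent_subst ha.const
    (by rw [← PowerSeries.constantCoeff, hf]; exact IsNilpotent.zero)

lemma subst_subst {σ τ : Type*} (f : PowerSeries A) {a : MvPowerSeries σ A}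
    (ha : PowerSeries.HasSubst a) {c : σ → MvPowerSeries τ A} (hc : MvPowerSeries.HasSubst c) :
    MvPowerSeries.subst c (PowerSeries.subst a f) =
      PowerSeries.subst (MvPowerSeries.subst c a) f :=
  MvPowerSeries.subst_comp_subst_apply ha.const hc f

lemma hasSubst_cons {σ : Type*} {a b : MvPowerSeries σ A} (ha : PowerSeries.HasSubst a)
    (hb : PowerSeries.HasSubst b) : MvPowerSeries.HasSubst ![a, b] :=
  MvPowerSeries.hasSubst_of_constantCoeff_nilpotent fun s => by fin_cases s <;> simpa

lemma hasSubst_subst_cons {σ : Type*} {H : MvPowerSeries (Fin 2) A}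
    (hH : MvPowerSeries.constantCoeff H = 0) {a b : MvPowerSeries σ A}
    (ha : PowerSeries.HasSubst a) (hb : PowerSeries.HasSubst b) :
    PowerSeries.HasSubst (MvPowerSeries.subst ![a, b] H) :=
  MvPowerSeries.IsNilpotent_subst (hasSubst_cons ha hb) (hH ▸ IsNilpotent.zero)

lemma subst_cons_subst {σ τ : Type*} (H : MvPowerSeries (Fin 2) A) {a b : MvPowerSeries σ A}
    (ha : PowerSeries.HasSubst a) (hb : PowerSeries.HasSubst b) {c : σ → MvPowerSeries τ A}
    (hc : MvPowerSeries.HasSubst c) :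
    MvPowerSeries.subst c (MvPowerSeries.subst ![a, b] H) =
      MvPowerSeries.subst ![MvPowerSeries.subst c a, MvPowerSeries.subst c b] H := by
  rw [MvPowerSeries.subst_comp_subst_apply (hasSubst_cons ha hb) hc]
  congr 1
  ext1 i
  fin_cases i <;> rfl

lemma subst_cons_X_X (H : MvPowerSeries (Fin 2) A) :
    MvPowerSeries.subst (![MvPowerSeries.X 0, MvPowerSeries.X 1] : Fin 2 → MvPowerSeries _ A) H =
      H := by
  have h : (![MvPowerSeries.X 0, MvPowerSeries.X 1] : Fin 2 → MvPowerSeries (Fin 2) A) =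
      MvPowerSeries.X := by
    ext1 i; fin_cases i <;> rfl
  rw [h, MvPowerSeries.subst_self, id]

lemma coeff_one_pow_mul_pow {a b : PowerSeries A} (ha : PowerSeries.constantCoeff a = 0)
    (hb : PowerSeries.constantCoeff b = 0) {r s : ℕ} (hrs : r + s ≠ 1) :
    PowerSeries.coeff 1 (a ^ r * b ^ s) = 0 := by
  obtain ⟨a, rfl⟩ := PowerSeries.X_dvd_iff.mpr ha
  obtain ⟨b, rfl⟩ := PowerSeries.X_dvd_iff.mpr hb
  have hX : (PowerSeries.X * a) ^ r * (PowerSeries.X * b) ^ s =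
      PowerSeries.X ^ (r + s) * (a ^ r * b ^ s) := by ring
  rw [hX, PowerSeries.coeff_X_pow_mul']
  split_ifs with h
  · obtain ⟨rfl, rfl⟩ : r = 0 ∧ s = 0 := by omega
    simp [PowerSeries.coeff_one]
  · rfl

lemma coeff_one_subst_cons (H : MvPowerSeries (Fin 2) A) {a b : PowerSeries A}
    (ha : PowerSeries.constantCoeff a = 0) (hb : PowerSeries.constantCoeff b = 0) :
    PowerSeries.coeff 1 (MvPowerSeries.subst ![a, b] H : PowerSeries A) =
      MvPowerSeries.coeff (Finsupp.single 0 1) H * PowerSeries.coeff 1 a +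
      MvPowerSeries.coeff (Finsupp.single 1 1) H * PowerSeries.coeff 1 b := by
  have hs := hasSubst_cons (.of_constantCoeff_zero' ha) (.of_constantCoeff_zero' hb)
  have hne : (Finsupp.single 0 1 : Fin 2 →₀ ℕ) ≠ Finsupp.single 1 1 := fun h => by
    simpa using DFunLike.congr_fun h 0
  rw [PowerSeries.coeff, MvPowerSeries.coeff_subst hs,
    finsum_eq_sum_of_support_subset (s := {Finsupp.single 0 1, Finsupp.single 1 1})]
  · rw [Finset.sum_pair hne]
    simp
  · refine Function.support_subset_iff'.mpr fun d hd => ?_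
    have hd1 : d 0 + d 1 ≠ 1 := fun h => hd <| by
      rw [Finset.mem_coe, Finset.mem_insert, Finset.mem_singleton]
      obtain ⟨h0, h1⟩ | ⟨h0, h1⟩ : (d 0 = 1 ∧ d 1 = 0) ∨ (d 0 = 0 ∧ d 1 = 1) := by omega
      · left; ext i; fin_cases i <;> simp [h0, h1]
      · right; ext i; fin_cases i <;> simp [h0, h1]
    have hprod : (d.prod fun s e => ![a, b] s ^ e) = a ^ d 0 * b ^ d 1 := by
      rw [Finsupp.prod_fintype _ _ (by simp)]
      simp
    rw [hprod]
    exact (congrArg _ (coeff_one_pow_mul_pow ha hb hd1)).trans (smul_zero _)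

end Substitution

section Transport

variable {A : Type*} [CommRing A]

/-- `f` and `g` are power series without constant term that are inverse to each other under
composition, i.e. `f` is a change of coordinates with inverse `g`. -/
structure IsCompInverse (f g : PowerSeries A) : Prop where
  constantCoeff_left : PowerSeries.constantCoeff f = 0
  constantCoeff_right : PowerSeries.constantCoeff g = 0
  subst_left : PowerSeries.subst f g = PowerSeries.X
  subst_right : PowerSeries.subst g f = PowerSeries.X

namespace IsCompInverse

variable {f g : PowerSeries A}

lemma hasSubst_left (h : IsCompInverse f g) : PowerSeries.HasSubst f :=
  .of_constantCoeff_zero' h.constantCoeff_left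

lemma hasSubst_right (h : IsCompInverse f g) : PowerSeries.HasSubst g :=
  .of_constantCoeff_zero' h.constantCoeff_right

lemma symm (h : IsCompInverse f g) : IsCompInverse g f :=
  ⟨h.constantCoeff_right, h.constantCoeff_left, h.subst_right, h.subst_left⟩

lemma subst_subst_left (h : IsCompInverse f g) {σ : Type*} {a : MvPowerSeries σ A}
    (ha : PowerSeries.HasSubst a) : PowerSeries.subst (PowerSeries.subst a f) g = a := by
  rw [← PowerSeries.subst_comp_subst_apply h.hasSubst_left ha, h.subst_left,
    PowerSeries.subst_X ha]

lemma isUnit_coeff_one (h : IsCompInverse f g) : IsUnit (PowerSeries.coeff 1 f) := by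
  refine .of_mul_eq_one (PowerSeries.coeff 1 g) ?_
  rw [mul_comm, ← coeff_one_subst h.constantCoeff_left, h.subst_left, PowerSeries.coeff_one_X]

lemma map {B : Type*} [CommRing B] (h : IsCompInverse f g) (π : A →+* B) :
    IsCompInverse (PowerSeries.map π f) (PowerSeries.map π g) where
  constantCoeff_left := (congrArg π h.constantCoeff_left).trans (map_zero π)
  constantCoeff_right := (congrArg π h.constantCoeff_right).trans (map_zero π)
  subst_left := by
    rw [← map_subst_powerSeries π h.hasSubst_left, h.subst_left, PowerSeries.map_X]
  subst_right := by
    rw [← map_subst_powerSeries π h.hasSubst_right, h.subst_right, PowerSeries.map_X]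

lemma substInvOfIsUnit (hf : PowerSeries.constantCoeff f = 0)
    (hu : IsUnit (PowerSeries.coeff 1 f)) : IsCompInverse f (f.substInvOfIsUnit hu) :=
  ⟨hf, f.constantCoeff_substInvOfIsUnit hu, f.subst_substInvOfIsUnit_left hf hu,
    f.subst_substInvOfIsUnit_right hf hu⟩

end IsCompInverse

variable {F G : FormalGroup A} {f g : PowerSeries A}

lemma subst_apply_of_isHom {σ : Type*} (hf : F.IsHom G f) {a b : MvPowerSeries σ A}
    (ha : PowerSeries.HasSubst a) (hb : PowerSeries.HasSubst b) :
    PowerSeries.subst (MvPowerSeries.subst ![a, b] F.toPowerSeries) f =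
      MvPowerSeries.subst ![PowerSeries.subst a f, PowerSeries.subst b f] G.toPowerSeries := by
  have hab := hasSubst_cons ha hb
  have h := congrArg (MvPowerSeries.subst ![a, b]) hf.subst_eq
  rw [subst_subst _ F.hasSubst_toPowerSeries hab,
    subst_cons_subst _ (hasSubst_subst hf.constantCoeff_eq_zero (.X 0))
      (hasSubst_subst hf.constantCoeff_eq_zero (.X 1)) hab,
    subst_subst _ (.X 0) hab, subst_subst _ (.X 1) hab, MvPowerSeries.subst_X hab,
    MvPowerSeries.subst_X hab] at h
  exact h

/-- The power series `f (F (g X, g Y))`, which is the formal group law `F` read in the coordinate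
`f` if `g` is the compositional inverse of `f`. -/
def conjSeries (F : FormalGroup A) (f g : PowerSeries A) : MvPowerSeries (Fin 2) A :=
  PowerSeries.subst (MvPowerSeries.subst ![
    PowerSeries.subst (MvPowerSeries.X 0 : MvPowerSeries (Fin 2) A) g,
    PowerSeries.subst (MvPowerSeries.X 1 : MvPowerSeries (Fin 2) A) g] F.toPowerSeries) f

lemma subst_conjSeries (F : FormalGroup A) {σ : Type*} (f : PowerSeries A)
    (hg : PowerSeries.constantCoeff g = 0) {a b : MvPowerSeries σ A}
    (ha : PowerSeries.HasSubst a) (hb : PowerSeries.HasSubst b) :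
    MvPowerSeries.subst ![a, b] (conjSeries F f g) =
      PowerSeries.subst (MvPowerSeries.subst ![PowerSeries.subst a g, PowerSeries.subst b g]
        F.toPowerSeries) f := by
  have hab := hasSubst_cons ha hb
  have h0 := hasSubst_subst hg (.X (0 : Fin 2))
  have h1 := hasSubst_subst hg (.X (1 : Fin 2))
  rw [conjSeries, subst_subst _ (hasSubst_subst_cons F.zero_constantCoeff h0 h1) hab,
    subst_cons_subst _ h0 h1 hab, subst_subst _ (.X 0) hab, subst_subst _ (.X 1) hab,
    MvPowerSeries.subst_X hab, MvPowerSeries.subst_X hab]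
  rfl

lemma subst_subst_conjSeries (F : FormalGroup A) {σ : Type*} (h : IsCompInverse f g)
    {a b : MvPowerSeries σ A} (ha : PowerSeries.HasSubst a) (hb : PowerSeries.HasSubst b) :
    PowerSeries.subst (MvPowerSeries.subst ![a, b] (conjSeries F f g)) g =
      MvPowerSeries.subst ![PowerSeries.subst a g, PowerSeries.subst b g] F.toPowerSeries := by
  rw [subst_conjSeries F f h.constantCoeff_right ha hb]
  exact h.subst_subst_left (hasSubst_subst_cons F.zero_constantCoeff
    (hasSubst_subst h.constantCoeff_right ha) (hasSubst_subst h.constantCoeff_right hb))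

lemma constantCoeff_conjSeries (F : FormalGroup A) (hf : PowerSeries.constantCoeff f = 0)
    (hg : PowerSeries.constantCoeff g = 0) :
    MvPowerSeries.constantCoeff (conjSeries F f g) = 0 := by
  refine PowerSeries.constantCoeff_subst_eq_zero (MvPowerSeries.constantCoeff_subst_eq_zero
    (FormalGroup.hasSubst_pair hg) (fun i => ?_) F.zero_constantCoeff) f hf
  fin_cases i <;> exact PowerSeries.constantCoeff_subst_eq_zero (by simp) g hg

/-- The formal group law `f (F (g X, g Y))` obtained from `F` by the change of coordinates `f`
with inverse `g`. -/
def conj (F : FormalGroup A) (h : IsCompInverse f g) : FormalGroup A where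
  toPowerSeries := conjSeries F f g
  zero_constantCoeff := constantCoeff_conjSeries F h.constantCoeff_left h.constantCoeff_right
  lin_coeff_X := by
    have hX := coeff_one_subst_cons (conjSeries F f g) (a := PowerSeries.X) (b := 0)
      (by simp) (by simp)
    rw [subst_conjSeries F f h.constantCoeff_right .X' .zero', PowerSeries.X_subst,
      PowerSeries.subst_zero_of_constantCoeff_zero h.constantCoeff_right,
      F.add_zero h.hasSubst_right, h.subst_right] at hX
    simpa using hX.symm
  lin_coeff_Y := by
    have hY := coeff_one_subst_cons (conjSeries F f g) (a := 0) (b := PowerSeries.X)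
      (by simp) (by simp)
    rw [subst_conjSeries F f h.constantCoeff_right .zero' .X', PowerSeries.X_subst,
      PowerSeries.subst_zero_of_constantCoeff_zero h.constantCoeff_right,
      F.zero_add h.hasSubst_right, h.subst_right] at hY
    simpa using hY.symm
  assoc := by
    have hc := constantCoeff_conjSeries F h.constantCoeff_left h.constantCoeff_right
    have hX (i : Fin 3) := PowerSeries.HasSubst.X (S := A) i
    have hgX (i : Fin 3) := hasSubst_subst h.constantCoeff_right (hX i)
    rw [subst_conjSeries F f h.constantCoeff_right (hasSubst_subst_cons hc (hX 0) (hX 1)) (hX 2),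
      subst_conjSeries F f h.constantCoeff_right (hX 0) (hasSubst_subst_cons hc (hX 1) (hX 2)),
      subst_subst_conjSeries F h (hX 0) (hX 1), subst_subst_conjSeries F h (hX 1) (hX 2),
      F.assoc' (hgX 0) (hgX 1) (hgX 2)]

lemma isComm_conj [F.IsComm] (h : IsCompInverse f g) : (conj F h).IsComm where
  comm := by
    change conjSeries F f g = MvPowerSeries.subst _ (conjSeries F f g)
    rw [subst_conjSeries F f h.constantCoeff_right (.X 1) (.X 0),
      F.comm' (hasSubst_subst h.constantCoeff_right (.X 1))
        (hasSubst_subst h.constantCoeff_right (.X 0))]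
    rfl

lemma isHom_conj (F : FormalGroup A) (h : IsCompInverse f g) : F.IsHom (conj F h) f where
  constantCoeff_eq_zero := h.constantCoeff_left
  subst_eq := by
    change _ = MvPowerSeries.subst _ (conjSeries F f g)
    rw [subst_conjSeries F f h.constantCoeff_right (hasSubst_subst h.constantCoeff_left (.X 0))
      (hasSubst_subst h.constantCoeff_left (.X 1)), h.subst_subst_left (.X 0),
      h.subst_subst_left (.X 1), subst_cons_X_X]

lemma eq_conj_of_isHom (hf : F.IsHom G f) (h : IsCompInverse f g) : G = conj F h := by
  have hG := subst_apply_of_isHom hf (hasSubst_subst h.constantCoeff_right (.X (0 : Fin 2)))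
    (hasSubst_subst h.constantCoeff_right (.X 1))
  rw [h.symm.subst_subst_left (.X 0), h.symm.subst_subst_left (.X 1), subst_cons_X_X] at hG
  exact FormalGroup.ext hG.symm

lemma isHom_symm (hf : F.IsHom G f) (h : IsCompInverse f g) : G.IsHom F g where
  constantCoeff_eq_zero := h.constantCoeff_right
  subst_eq := by
    have hF := subst_subst_conjSeries F h (.X (0 : Fin 2)) (.X 1)
    rw [subst_cons_X_X] at hF
    rw [eq_conj_of_isHom hf h]
    exact hF

lemma isIsom_of_isHom (hf : F.IsHom G f) (hu : IsUnit (PowerSeries.coeff 1 f)) :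
    F.IsIsom G f :=
  have h := IsCompInverse.substInvOfIsUnit hf.constantCoeff_eq_zero hu
  ⟨hf, _, isHom_symm hf h, h.subst_left, h.subst_right⟩

lemma exists_isCompInverse_of_isIsom (hf : F.IsIsom G f) :
    ∃ g, IsCompInverse f g ∧ G.IsHom F g := by
  obtain ⟨hf, g, hg, hgf, hfg⟩ := hf
  exact ⟨g, ⟨hf.constantCoeff_eq_zero, hg.constantCoeff_eq_zero, hgf, hfg⟩, hg⟩

lemma isUnit_coeff_one_of_isIsom (hf : F.IsIsom G f) : IsUnit (PowerSeries.coeff 1 f) := by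
  obtain ⟨g, h, -⟩ := exists_isCompInverse_of_isIsom hf
  exact h.isUnit_coeff_one

lemma isComm_of_isIsom [F.IsComm] (hf : F.IsIsom G f) : G.IsComm := by
  obtain ⟨g, h, -⟩ := exists_isCompInverse_of_isIsom hf
  rw [eq_conj_of_isHom hf.1 h]
  exact isComm_conj h

variable {B : Type*} [CommRing B] (π : A →+* B)

lemma map_map {D : Type*} [CommRing D] (F : FormalGroup A) (ρ : B →+* D) :
    (F.map π).map ρ = F.map (ρ.comp π) := by
  ext1
  simp [MvPowerSeries.map_map]

lemma isComm_map [F.IsComm] : (F.map π).IsComm where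
  comm := by
    have h := congrArg (MvPowerSeries.map π) (FormalGroup.IsComm.comm (F := F))
    rw [MvPowerSeries.map_subst .X_X] at h
    rw [FormalGroup.map_toPowerSeries]
    refine h.trans ?_
    congr 1
    ext1 i
    fin_cases i <;> simp

variable {π}

lemma exists_constantCoeff_eq_zero_map_eq (hπ : Function.Surjective π) {f₀ : PowerSeries B}
    (hf₀ : PowerSeries.constantCoeff f₀ = 0) :
    ∃ f : PowerSeries A, PowerSeries.constantCoeff f = 0 ∧ PowerSeries.map π f = f₀ := by
  obtain ⟨h₀, rfl⟩ := PowerSeries.X_dvd_iff.mpr hf₀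
  obtain ⟨h, rfl⟩ := PowerSeries.map_surjective π hπ h₀
  exact ⟨PowerSeries.X * h, by simp, by simp⟩

theorem exists_isIsom_map_eq (hπ : Function.Surjective π) [IsLocalHom π] {G₀ : FormalGroup B}
    {f₀ : PowerSeries B} (hf₀ : (F.map π).IsHom G₀ f₀) (hu : IsUnit (PowerSeries.coeff 1 f₀)) :
    ∃ G f, F.IsIsom G f ∧ G.map π = G₀ ∧ PowerSeries.map π f = f₀ := by
  obtain ⟨f, hf, rfl⟩ := exists_constantCoeff_eq_zero_map_eq hπ hf₀.constantCoeff_eq_zero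
  have hu : IsUnit (PowerSeries.coeff 1 f) := by
    rw [PowerSeries.coeff_map] at hu
    exact isUnit_of_map_unit π _ hu
  have h := IsCompInverse.substInvOfIsUnit hf hu
  refine ⟨conj F h, f, isIsom_of_isHom (isHom_conj F h) hu, ?_, rfl⟩
  rw [eq_conj_of_isHom hf₀ (h.map π), ← eq_conj_of_isHom ((isHom_conj F h).map π) (h.map π)]

end Transport

section Multiplication

variable {A : Type*} [CommRing A]

lemma constantCoeff_mulSeries (F : FormalGroup A) (m : ℕ) :
    PowerSeries.constantCoeff (F.mulSeries m) = 0 := by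
  induction m with
  | zero => simp [FormalGroup.mulSeries]
  | succ m ih =>
    refine MvPowerSeries.constantCoeff_subst_eq_zero
      (hasSubst_cons (.of_constantCoeff_zero' ih) .X') (fun i => ?_) F.zero_constantCoeff
    fin_cases i
    · exact ih
    · exact PowerSeries.constantCoeff_X

lemma hasSubst_mulSeries (F : FormalGroup A) (m : ℕ) : PowerSeries.HasSubst (F.mulSeries m) :=
  .of_constantCoeff_zero' (constantCoeff_mulSeries F m)

lemma coeff_one_mulSeries (F : FormalGroup A) (m : ℕ) :
    PowerSeries.coeff 1 (F.mulSeries m) = m := by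
  induction m with
  | zero => simp [FormalGroup.mulSeries]
  | succ m ih =>
    rw [FormalGroup.mulSeries, coeff_one_subst_cons _ (constantCoeff_mulSeries F m) (by simp), ih,
      F.lin_coeff_X, F.lin_coeff_Y]
    simp

lemma map_mulSeries {B : Type*} [CommRing B] (F : FormalGroup A) (π : A →+* B) (m : ℕ) :
    (F.map π).mulSeries m = PowerSeries.map π (F.mulSeries m) := by
  induction m with
  | zero => simp [FormalGroup.mulSeries]
  | succ m ih =>
    rw [FormalGroup.mulSeries, FormalGroup.mulSeries, PowerSeries.map,
      MvPowerSeries.map_subst (hasSubst_cons (hasSubst_mulSeries F m) .X'), ih,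
      FormalGroup.map_toPowerSeries]
    congr 1
    ext1 i
    fin_cases i
    · rfl
    · exact (PowerSeries.map_X π).symm

lemma subst_mulSeries_of_isHom {F G : FormalGroup A} {f : PowerSeries A} (hf : F.IsHom G f)
    (m : ℕ) : PowerSeries.subst (F.mulSeries m) f = PowerSeries.subst f (G.mulSeries m) := by
  induction m with
  | zero =>
    rw [FormalGroup.mulSeries, FormalGroup.mulSeries,
      PowerSeries.subst_zero_of_constantCoeff_zero hf.constantCoeff_eq_zero,
      ← PowerSeries.coe_substAlgHom hf.hasSubst, map_zero]
  | succ m ih =>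
    have hG := subst_cons_subst G.toPowerSeries (hasSubst_mulSeries G m) .X' hf.hasSubst.const
    rw [FormalGroup.mulSeries, FormalGroup.mulSeries,
      subst_apply_of_isHom hf (hasSubst_mulSeries F m) .X', ih]
    refine Eq.trans ?_ hG.symm
    congr 3
    rw [PowerSeries.X_subst]
    exact (PowerSeries.subst_X hf.hasSubst).symm

variable {F : FormalGroup A} {p n : ℕ}

lemma hasHeight_map {k B : Type*} [Field k] [CommRing B] [Nontrivial B] {F : FormalGroup k}
    (h : F.HasHeight p n) (hp : p ≠ 0) (π : k →+* B) : (F.map π).HasHeight p n := by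
  obtain ⟨g, hg, hFg⟩ := h
  refine ⟨PowerSeries.map π g, by simpa using hg, ?_⟩
  rw [map_mulSeries, hFg, map_subst_powerSeries π (.X_pow (pow_ne_zero n hp)), map_pow,
    PowerSeries.map_X]

lemma ne_zero_of_hasHeight [CharP A p] (h : F.HasHeight p n) : n ≠ 0 := by
  rintro rfl
  obtain ⟨g, hg, hFg⟩ := h
  have hp := coeff_one_mulSeries F p
  rw [hFg, pow_zero, pow_one, PowerSeries.X_subst, CharP.cast_eq_zero] at hp
  exact hg hp

lemma coeff_mulSeries_eq_zero_of_not_dvd [CharP A p] (h : F.HasHeight p n) (hp : p ≠ 0) {i : ℕ}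
    (hi : ¬ p ∣ i) : PowerSeries.coeff i (F.mulSeries p) = 0 := by
  have hpn : p ∣ p ^ n := dvd_pow_self p (ne_zero_of_hasHeight h)
  obtain ⟨g, -, hFg⟩ := h
  rw [hFg, PowerSeries.coeff_subst_X_pow (pow_ne_zero n hp), if_neg fun hd => hi (hpn.trans hd)]

lemma mulSeries_ne_zero_of_hasHeight (h : F.HasHeight p n) (hp : p ≠ 0) :
    F.mulSeries p ≠ 0 := by
  obtain ⟨g, hg, hFg⟩ := h
  intro h0
  have hcoeff := congrArg (PowerSeries.coeff (p ^ n)) (hFg.symm.trans h0)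
  rw [PowerSeries.coeff_subst_X_pow (pow_ne_zero n hp), if_pos dvd_rfl,
    Nat.div_self (Nat.pos_of_ne_zero (pow_ne_zero n hp))] at hcoeff
  exact hg (by simpa using hcoeff)

end Multiplication

section Congruences

open PowerSeries

variable {A : Type*} [CommRing A] {I M : Ideal A} {p : ℕ} {f f' : PowerSeries A}

lemma finsum_mem_ideal {ι : Sort*} {u : ι → A} (h : ∀ i, u i ∈ I) : ∑ᶠ i, u i ∈ I :=
  finsum_induction (· ∈ I) (zero_mem I) (fun _ _ => add_mem) h

lemma coeff_pow_sub_pow_mem (h : ∀ i, coeff i (f - f') ∈ I) (d i : ℕ) :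
    coeff i (f ^ d - f' ^ d) ∈ I := by
  obtain ⟨q, hq⟩ := sub_dvd_pow_sub_pow f f' d
  rw [hq]
  exact coeff_mul_mem_ideal_of_coeff_left_mem_ideal' h i

lemma coeff_pow_sub_pow_mem_mul (hIM : I ≤ M) (hp : (p : A) ∈ M)
    (h : ∀ i, coeff i (f - f') ∈ I) (i : ℕ) : coeff i (f ^ p - f' ^ p) ∈ I * M := by
  obtain ⟨q, hq⟩ := Polynomial.powAddExpansion f' (f - f') p
  have hfactor : f ^ p - f' ^ p = (f - f') * (C (p : A) * f' ^ (p - 1) + q * (f - f')) := by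
    rw [add_sub_cancel] at hq
    rw [hq, map_natCast]
    ring
  rw [hfactor]
  refine coeff_mul_mem_ideal_mul_ideal_of_coeff_mem_ideal' h (fun j => ?_) i
  rw [map_add, coeff_C_mul]
  exact add_mem (Ideal.mul_mem_right _ _ hp)
    (hIM (coeff_mul_mem_ideal_of_coeff_right_mem_ideal' h j))

lemma coeff_subst_sub_subst_mem_mul (hIM : I ≤ M) (hp : (p : A) ∈ M) (hf : HasSubst f)
    (hf' : HasSubst f') (h : ∀ i, coeff i (f - f') ∈ I) {P : PowerSeries A}
    (hP : ∀ i, ¬ p ∣ i → coeff i P ∈ M) (i : ℕ) :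
    coeff i (subst f P - subst f' P) ∈ I * M := by
  rw [map_sub, coeff_subst' hf, coeff_subst' hf',
    ← finsum_sub_distrib (coeff_subst_finite' hf P i) (coeff_subst_finite' hf' P i)]
  refine finsum_mem_ideal fun d => ?_
  rw [← smul_sub, ← map_sub, smul_eq_mul]
  by_cases hd : p ∣ d
  · obtain ⟨e, rfl⟩ := hd
    rw [pow_mul, pow_mul]
    exact Ideal.mul_mem_left _ _ (coeff_pow_sub_pow_mem (coeff_pow_sub_pow_mem_mul hIM hp h) e i)
  · rw [mul_comm I]
    exact Ideal.mul_mem_mul (hP d hd) (coeff_pow_sub_pow_mem h d i)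

variable [IsLocalRing A] {U : PowerSeries A}

lemma exists_coeff_pow_mem_maximalIdeal_and_isUnit (hU₀ : constantCoeff U = 0)
    (hU : map (residue A) U ≠ 0) :
    ∃ q, ∀ i, (∀ d, i < d → coeff (q * i) (U ^ d) ∈ maximalIdeal A) ∧
      IsUnit (coeff (q * i) (U ^ i)) := by
  obtain ⟨q, W, hUW, hW⟩ : ∃ q W, map (residue A) U = X ^ q * W ∧ constantCoeff W ≠ 0 :=
    ⟨_, _, (X_pow_order_mul_divXPowOrder (f := map (residue A) U)).symm, fun h =>
      hU (constantCoeff_divXPowOrder_eq_zero_iff.mp h)⟩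
  have hq : 0 < q := by
    refine Nat.pos_of_ne_zero ?_
    rintro rfl
    refine hW ?_
    rw [pow_zero, one_mul] at hUW
    rw [← hUW]
    exact (congrArg (residue A) hU₀).trans (map_zero _)
  have hcoeff (i d : ℕ) : residue A (coeff (q * i) (U ^ d)) =
      coeff (q * i) (X ^ (q * d) * W ^ d) := by
    rw [← coeff_map, map_pow, hUW, mul_pow, pow_mul]
  refine ⟨q, fun i => ⟨fun d hd => ?_, ?_⟩⟩
  · rw [← residue_eq_zero_iff, hcoeff, coeff_X_pow_mul',
      if_neg (not_le.mpr (Nat.mul_lt_mul_of_pos_left hd hq))]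
  · rw [← residue_ne_zero_iff_isUnit, hcoeff, coeff_X_pow_mul', if_pos le_rfl, Nat.sub_self]
    simpa using pow_ne_zero i hW

lemma coeff_mem_mul_maximalIdeal_of_coeff_subst_mem (hU₀ : constantCoeff U = 0)
    (hU : map (residue A) U ≠ 0) {δ : PowerSeries A} (hδ : ∀ i, coeff i δ ∈ I)
    (h : ∀ i, coeff i (subst U δ) ∈ I * maximalIdeal A) (i : ℕ) :
    coeff i δ ∈ I * maximalIdeal A := by
  obtain ⟨q, hq⟩ := exists_coeff_pow_mem_maximalIdeal_and_isUnit hU₀ hU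
  have hsubst : HasSubst U := .of_constantCoeff_zero' hU₀
  induction i using Nat.strong_induction_on with
  | _ i ih =>
    have hi := h (q * i)
    rw [coeff_subst' hsubst, ← add_finsum_cond_ne i (coeff_subst_finite' hsubst δ (q * i))] at hi
    have hrest : ∑ᶠ (d) (_ : d ≠ i), coeff d δ • coeff (q * i) (U ^ d) ∈ I * maximalIdeal A := by
      refine finsum_mem_ideal fun d => finsum_mem_ideal fun hd => ?_
      rw [smul_eq_mul]
      obtain hlt | hgt := lt_or_gt_of_ne hd
      · exact Ideal.mul_mem_right _ _ (ih d hlt)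
      · exact Ideal.mul_mem_mul (hδ d) ((hq i).1 d hgt)
    have hmain := (Submodule.add_mem_iff_left _ hrest).mp hi
    rwa [smul_eq_mul, mul_comm (coeff i δ), Ideal.unit_mul_mem_iff_mem _ (hq i).2] at hmain

end Congruences

section Rigidity

variable {A : Type*} [CommRing A] [IsLocalRing A] {p n n' : ℕ} [CharP (ResidueField A) p]
  {F G : FormalGroup A} {f f' : PowerSeries A}

lemma coeff_sub_mem_mul_maximalIdeal_of_isHom (hp : p ≠ 0)
    (hF : (F.map (residue A)).HasHeight p n) (hG : (G.map (residue A)).HasHeight p n')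
    (hf : F.IsHom G f) (hf' : F.IsHom G f') {I : Ideal A} (hI : I ≤ maximalIdeal A)
    (h : ∀ i, PowerSeries.coeff i (f - f') ∈ I) (i : ℕ) :
    PowerSeries.coeff i (f - f') ∈ I * maximalIdeal A := by
  have hpm : (p : A) ∈ maximalIdeal A := by
    rw [← residue_eq_zero_iff, map_natCast, CharP.cast_eq_zero]
  have hFp : PowerSeries.map (residue A) (F.mulSeries p) ≠ 0 := by
    rw [← map_mulSeries]
    exact mulSeries_ne_zero_of_hasHeight hF hp
  have hGp (j : ℕ) (hj : ¬ p ∣ j) : PowerSeries.coeff j (G.mulSeries p) ∈ maximalIdeal A := by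
    rw [← residue_eq_zero_iff, ← PowerSeries.coeff_map, ← map_mulSeries]
    exact coeff_mulSeries_eq_zero_of_not_dvd hG hp hj
  refine coeff_mem_mul_maximalIdeal_of_coeff_subst_mem (constantCoeff_mulSeries F p) hFp h
    (fun j => ?_) i
  rw [PowerSeries.subst_sub (hasSubst_mulSeries F p), subst_mulSeries_of_isHom hf,
    subst_mulSeries_of_isHom hf']
  exact coeff_subst_sub_subst_mem_mul hI hpm hf.hasSubst hf'.hasSubst h hGp j

theorem eq_of_isHom_of_map_residue_eq [IsHausdorff (maximalIdeal A) A] (hp : p ≠ 0)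
    (hF : (F.map (residue A)).HasHeight p n) (hG : (G.map (residue A)).HasHeight p n')
    (hf : F.IsHom G f) (hf' : F.IsHom G f')
    (h : PowerSeries.map (residue A) f = PowerSeries.map (residue A) f') : f = f' := by
  have hmem (r : ℕ) : ∀ i, PowerSeries.coeff i (f - f') ∈ maximalIdeal A ^ (r + 1) := by
    induction r with
    | zero =>
      intro i
      rw [zero_add, pow_one, ← residue_eq_zero_iff, ← PowerSeries.coeff_map, map_sub, h,
        sub_self, map_zero]
    | succ r ih =>
      rw [pow_succ]
      exact coeff_sub_mem_mul_maximalIdeal_of_isHom hp hF hG hf hf'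
        (Ideal.pow_le_self r.succ_ne_zero) ih
  rw [← sub_eq_zero]
  ext i
  refine IsHausdorff.haus (I := maximalIdeal A) inferInstance _ fun r => ?_
  rw [sModEq_pow_smul_top_iff, sub_zero]
  exact Ideal.pow_le_pow_right r.le_succ (hmem r i)

end Rigidity

end LubinTate

open LubinTate

section StarIsomorphic

variable {A : Type*} [CommRing A] [IsLocalRing A]

lemma StarIsomorphic.of_isIsom {F G₁ G₂ : FormalGroup A} {f₁ f₂ : PowerSeries A}
    (h₁ : F.IsIsom G₁ f₁) (h₂ : F.IsIsom G₂ f₂)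
    (h : PowerSeries.map (residue A) f₁ = PowerSeries.map (residue A) f₂) :
    StarIsomorphic G₁ G₂ := by
  obtain ⟨g, hg, hgHom⟩ := exists_isCompInverse_of_isIsom h₁
  refine ⟨PowerSeries.subst g f₂, isIsom_of_isHom (h₂.1.comp hgHom) ?_, ?_⟩
  · rw [coeff_one_subst hg.constantCoeff_right]
    exact (isUnit_coeff_one_of_isIsom h₂).mul hg.symm.isUnit_coeff_one
  · rw [map_subst_powerSeries _ hg.hasSubst_right, ← h,
      ← map_subst_powerSeries _ hg.hasSubst_right, hg.subst_right, PowerSeries.map_X]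

lemma StarIsomorphic.symm {G₁ G₂ : FormalGroup A} (h : StarIsomorphic G₁ G₂) :
    StarIsomorphic G₂ G₁ := by
  obtain ⟨u, hu, hu₁⟩ := h
  refine .of_isIsom hu (isIsom_of_isHom G₁.isHom_id ?_) (hu₁.trans (PowerSeries.map_X _).symm)
  rw [PowerSeries.coeff_one_X]
  exact isUnit_one

end StarIsomorphic

section Lift

lemma FGLHom.isUnit_coeff_one_of_isIso {A B : Type*} [CommRing A] [CommRing B]
    {F : FormalGroup A} {G : FormalGroup B} {φ : FGLHom F G} (hφ : φ.IsIso) :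
    IsUnit (PowerSeries.coeff 1 φ.series) := by
  obtain ⟨ψ, -, hψφ⟩ := hφ
  have hX : PowerSeries.subst φ.series (PowerSeries.map φ.ringHom ψ.series) = PowerSeries.X :=
    congrArg FGLHom.series hψφ
  have h₁ := coeff_one_subst φ.isHom.constantCoeff_eq_zero (PowerSeries.map φ.ringHom ψ.series)
  rw [hX, PowerSeries.coeff_one_X, mul_comm] at h₁
  exact .of_mul_eq_one _ h₁.symm

universe u

variable {R : Type u} [CommRing R] [IsLocalRing R] {F G H : FormalGroup (ResidueField R)}

lemma IsUniversalDeformation.existsUnique_ringHom {m : ℕ}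
    {Gt : FormalGroup (MvPowerSeries (Fin m) R)} (hGt : IsUniversalDeformation G Gt)
    {A : Type u} [CommRing A] [IsLocalRing A] [IsNoetherianRing A]
    [IsAdicComplete (maximalIdeal A) A] (ρ : R →+* A) [hρ : IsLocalHom ρ] {G' : FormalGroup A}
    (hcomm : G'.IsComm) (hG' : G.map (ResidueField.map ρ) = G'.map (residue A)) :
    ∃! β : MvPowerSeries (Fin m) R →+* A, β.comp (algebraMap R _) = ρ ∧ IsLocalHom β ∧
      StarIsomorphic (Gt.map β) G' := by
  let : Algebra R A := ρ.toAlgebra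
  have : IsLocalHom (algebraMap R A) := hρ
  obtain ⟨β, hβ, hunique⟩ := hGt.existsUnique A G' ⟨hcomm, hG'⟩
  refine ⟨β, ⟨β.comp_algebraMap, hβ⟩, fun γ ⟨hγ, hγ'⟩ => ?_⟩
  exact congrArg AlgHom.toRingHom
    (hunique { γ with commutes' := fun r => RingHom.congr_fun hγ r } hγ')

variable {A B D : Type*} [CommRing A] [IsLocalRing A]

lemma isLocalHom_of_residue_comp {a : ResidueField R →+* ResidueField R} {α : R →+* R}
    (hα : ∀ r, a (residue R r) = residue R (α r)) : IsLocalHom α where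
  map_nonunit r hr := by
    rw [← residue_ne_zero_iff_isUnit, ← hα] at hr
    rw [← residue_ne_zero_iff_isUnit]
    exact ne_zero_of_map hr

lemma residueField_map_comp_eq (ι : R →+* A) [IsLocalHom ι] {α : R →+* R} [IsLocalHom α]
    {a : ResidueField R →+* ResidueField R} (hα : ∀ r, a (residue R r) = residue R (α r)) :
    ResidueField.map (ι.comp α) = (ResidueField.map ι).comp a := by
  refine RingHom.ext fun x => ?_
  obtain ⟨r, rfl⟩ := residue_surjective x
  simp [hα, ResidueField.map_residue]

variable [CommRing B] [IsLocalRing B] [Algebra R B] [IsLocalHom (algebraMap R B)]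
  {Gt : FormalGroup B}

lemma IsDeformation.map_residueField_map_comp (hGt : IsDeformation G Gt) (β : B →+* A)
    [IsLocalHom β] :
    G.map (ResidueField.map (β.comp (algebraMap R B))) = (Gt.map β).map (residue A) := by
  rw [ResidueField.map_comp, ← map_map, hGt.map_eq, map_map, map_map]
  rfl

variable [Algebra R A] [IsLocalHom (algebraMap R A)] {Ft : FormalGroup A}
  [CommRing D] [IsLocalRing D] [Algebra R D] [IsLocalHom (algebraMap R D)] {Ht : FormalGroup D}

/-- `φ` lifts `φ₀` over `α`: it induces `φ₀` on the residue field of `R`, and its ring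
homomorphism is `α`-linear. -/
structure FGLHom.IsLift (φ : FGLHom Ft Gt) (φ₀ : FGLHom F G) (α : R →+* R) : Prop where
  inducesOnResidueField : φ.InducesOnResidueField φ₀
  algebraMap_comp : (algebraMap R A).comp α = φ.ringHom.comp (algebraMap R B)

namespace FGLHom

variable {φ₀ : FGLHom F G} {ψ₀ : FGLHom G H} {α α' : R →+* R}

lemma isLift_id : (FGLHom.id Ft).IsLift (FGLHom.id F) (RingHom.id R) where
  inducesOnResidueField := by
    refine ⟨isLocalHom_id A, ?_, by simp [FGLHom.id]⟩
    refine RingHom.ext fun x => ?_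
    obtain ⟨r, rfl⟩ := residue_surjective x
    rfl
  algebraMap_comp := rfl

lemma IsLift.comp {ψ : FGLHom Gt Ht} {φ : FGLHom Ft Gt} (hψ : ψ.IsLift ψ₀ α')
    (hφ : φ.IsLift φ₀ α) : (ψ.comp φ).IsLift (ψ₀.comp φ₀) (α.comp α') where
  inducesOnResidueField := by
    obtain ⟨_, hring, hseries⟩ := hφ.inducesOnResidueField
    obtain ⟨_, hring', hseries'⟩ := hψ.inducesOnResidueField
    refine ⟨RingHom.isLocalHom_comp φ.ringHom ψ.ringHom, ?_, ?_⟩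
    · change (ResidueField.map (φ.ringHom.comp ψ.ringHom)).comp _ =
        (ResidueField.map (algebraMap R A)).comp (φ₀.ringHom.comp ψ₀.ringHom)
      rw [ResidueField.map_comp, RingHom.comp_assoc, hring', ← RingHom.comp_assoc, hring,
        RingHom.comp_assoc]
    · have hcoeff : PowerSeries.map (residue A) (PowerSeries.map φ.ringHom ψ.series) =
          PowerSeries.map (ResidueField.map (algebraMap R A))
            (PowerSeries.map φ₀.ringHom ψ₀.series) := by
        ext i
        have hi := congrArg (ResidueField.map φ.ringHom) (congrArg (PowerSeries.coeff i) hseries')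
        simp only [PowerSeries.coeff_map, ResidueField.map_residue] at hi ⊢
        exact hi.trans (RingHom.congr_fun hring _)
      simp only [FGLHom.comp]
      rw [map_subst_powerSeries _ φ.isHom.hasSubst, hseries, hcoeff,
        map_subst_powerSeries _ φ₀.isHom.hasSubst]
  algebraMap_comp := by
    change _ = (φ.ringHom.comp ψ.ringHom).comp _
    rw [RingHom.comp_assoc, ← hψ.algebraMap_comp, ← RingHom.comp_assoc, hφ.algebraMap_comp,
      RingHom.comp_assoc]

lemma IsLift.isUnit_coeff_one {φ : FGLHom Ft Gt} (hφ : φ.IsLift φ₀ α)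
    (hu : IsUnit (PowerSeries.coeff 1 φ₀.series)) : IsUnit (PowerSeries.coeff 1 φ.series) := by
  obtain ⟨_, -, hseries⟩ := hφ.inducesOnResidueField
  rw [← residue_ne_zero_iff_isUnit, ← PowerSeries.coeff_map, hseries, PowerSeries.coeff_map]
  exact (hu.map _).ne_zero

end FGLHom

namespace IsUniversalDeformation

variable {A : Type u} [CommRing A] [IsLocalRing A] [IsNoetherianRing A]
  [IsAdicComplete (maximalIdeal A) A] [Algebra R A] [IsLocalHom (algebraMap R A)]
  {Ft : FormalGroup A} {m : ℕ} {Gt : FormalGroup (MvPowerSeries (Fin m) R)}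
  {φ₀ : FGLHom F G} {α : R →+* R}

theorem exists_isLift (hGt : IsUniversalDeformation G Gt) (hFt : IsDeformation F Ft)
    (hu : IsUnit (PowerSeries.coeff 1 φ₀.series))
    (hα : ∀ r, φ₀.ringHom (residue R r) = residue R (α r)) :
    ∃ φ : FGLHom Ft Gt, φ.IsLift φ₀ α := by
  have := hFt.isComm
  have := isLocalHom_of_residue_comp hα
  have := RingHom.isLocalHom_comp (algebraMap R A) α
  have hρ := residueField_map_comp_eq (algebraMap R A) hα
  have hφ₀ := φ₀.isHom.map (ResidueField.map (algebraMap R A))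
  rw [hFt.map_eq, map_map, ← hρ] at hφ₀
  obtain ⟨G', f, hf, hG', hfφ₀⟩ :=
    exists_isIsom_map_eq residue_surjective hφ₀ (by rw [PowerSeries.coeff_map]; exact hu.map _)
  obtain ⟨β, ⟨hβα, hβ, hstar⟩, -⟩ :=
    hGt.existsUnique_ringHom ((algebraMap R A).comp α) (isComm_of_isIsom hf) hG'.symm
  obtain ⟨v, hv, hvX⟩ := hstar.symm
  refine ⟨⟨PowerSeries.subst f v, β, hv.1.comp hf.1⟩, ⟨⟨hβ, ?_, ?_⟩, hβα.symm⟩⟩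
  · rw [← hρ, ← ResidueField.map_comp]
    congr 1
  · rw [map_subst_powerSeries _ hf.1.hasSubst, hvX, hfφ₀, PowerSeries.subst_X hφ₀.hasSubst]

theorem isLift_unique (hGt : IsUniversalDeformation G Gt) (hFt : IsDeformation F Ft) {p n n' : ℕ}
    (hp : p ≠ 0) [CharP (ResidueField R) p] (hF : F.HasHeight p n) (hG : G.HasHeight p n')
    (hu : IsUnit (PowerSeries.coeff 1 φ₀.series)) {φ₁ φ₂ : FGLHom Ft Gt}
    (h₁ : φ₁.IsLift φ₀ α) (h₂ : φ₂.IsLift φ₀ α) : φ₁ = φ₂ := by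
  have := hGt.isDeformation.isComm
  obtain ⟨_, -, hseries₁⟩ := h₁.inducesOnResidueField
  obtain ⟨hβ₂, -, hseries₂⟩ := h₂.inducesOnResidueField
  have := RingHom.isLocalHom_comp φ₁.ringHom (algebraMap R (MvPowerSeries (Fin m) R))
  have hred := hGt.isDeformation.map_residueField_map_comp φ₁.ringHom
  have hseries := hseries₁.trans hseries₂.symm
  have hisom {φ : FGLHom Ft Gt} (h : φ.IsLift φ₀ α) : Ft.IsIsom (Gt.map φ.ringHom) φ.series :=
    isIsom_of_isHom φ.isHom (h.isUnit_coeff_one hu)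
  have hringHom : φ₁.ringHom = φ₂.ringHom :=
    (hGt.existsUnique_ringHom _ (isComm_map φ₁.ringHom) hred).unique
      ⟨rfl, ‹_›, .of_isIsom (hisom h₁) (hisom h₁) rfl⟩
      ⟨h₂.algebraMap_comp.symm.trans h₁.algebraMap_comp, hβ₂,
        .of_isIsom (hisom h₂) (hisom h₁) hseries.symm⟩
  have : CharP (ResidueField A) p :=
    charP_of_injective_ringHom (ResidueField.map (algebraMap R A)).injective p
  have hFt_height : (Ft.map (residue A)).HasHeight p n := hFt.map_eq ▸ hasHeight_map hF hp _
  have hGt_height : ((Gt.map φ₁.ringHom).map (residue A)).HasHeight p n' :=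
    hred ▸ hasHeight_map hG hp _
  exact FGLHom.ext (eq_of_isHom_of_map_residue_eq hp hFt_height hGt_height φ₁.isHom
    (hringHom ▸ φ₂.isHom) hseries) hringHom

end IsUniversalDeformation

theorem FGLHom.IsLift.isIso [IsNoetherianRing R] [IsAdicComplete (maximalIdeal R) R] {m m' : ℕ}
    {Ft : FormalGroup (MvPowerSeries (Fin m) R)} {Gt : FormalGroup (MvPowerSeries (Fin m') R)}
    {p n n' : ℕ} (hp : p ≠ 0) [CharP (ResidueField R) p] (hF : F.HasHeight p n)
    (hG : G.HasHeight p n') (hFt : IsUniversalDeformation F Ft)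
    (hGt : IsUniversalDeformation G Gt) {φ₀ : FGLHom F G} (hφ₀ : φ₀.IsIso) {α : R ≃+* R}
    (hα : ∀ r, φ₀.ringHom (residue R r) = residue R (α r)) {φ : FGLHom Ft Gt}
    (hφ : φ.IsLift φ₀ α) : φ.IsIso := by
  have := isAdicComplete_maximalIdeal_mvPowerSeries (A := R) m
  have := isAdicComplete_maximalIdeal_mvPowerSeries (A := R) m'
  obtain ⟨ψ₀, hφψ₀, hψφ₀⟩ := hφ₀
  have hα' (r : R) : ψ₀.ringHom (residue R r) = residue R (α.symm r) := by
    have h := RingHom.congr_fun (congrArg FGLHom.ringHom hφψ₀) (residue R (α.symm r))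
    change ψ₀.ringHom (φ₀.ringHom _) = residue R _ at h
    rwa [hα, α.apply_symm_apply] at h
  obtain ⟨ψ, hψ⟩ := hFt.exists_isLift (α := (α.symm : R →+* R)) hGt.isDeformation
    (FGLHom.isUnit_coeff_one_of_isIso ⟨φ₀, hψφ₀, hφψ₀⟩) hα'
  have hφψ := hφ.comp hψ
  have hψφ := hψ.comp hφ
  rw [hφψ₀, RingEquiv.symm_comp] at hφψ
  rw [hψφ₀, RingEquiv.comp_symm] at hψφ
  have hid {K : FormalGroup (ResidueField R)} :
      IsUnit (PowerSeries.coeff 1 (FGLHom.id K).series) := by simp [FGLHom.id]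
  exact ⟨ψ, hGt.isLift_unique hGt.isDeformation hp hG hG hid hφψ FGLHom.isLift_id,
    hFt.isLift_unique hFt.isDeformation hp hF hF hid hψφ FGLHom.isLift_id⟩

end Lift

end

theorem mainTheorem5 {R : Type*} [CommRing R] [IsLocalRing R] [IsNoetherianRing R]
    [IsAdicComplete (maximalIdeal R) R] (p n : ℕ) (hp : p.Prime) [CharP (ResidueField R) p]
    (F G : FormalGroup (ResidueField R)) [F.IsComm] [G.IsComm]
    (hF : F.HasHeight p n) (hG : G.HasHeight p n)
    (φ₀ : FGLHom F G) (hφ₀ : φ₀.IsIso)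
    (α : R ≃+* R) (hα : ∀ r : R, φ₀.ringHom (residue R r) = residue R (α r))
    (Ft Gt : FormalGroup (MvPowerSeries (Fin (n - 1)) R))
    (hFt : IsUniversalDeformation F Ft) (hGt : IsUniversalDeformation G Gt) :
    ∃! φ : FGLHom Ft Gt, φ.IsIso ∧ φ.InducesOnResidueField φ₀ ∧
      (MvPowerSeries.C : R →+* MvPowerSeries (Fin (n - 1)) R).comp (α : R →+* R) =
        φ.ringHom.comp (MvPowerSeries.C : R →+* MvPowerSeries (Fin (n - 1)) R) := by
  have := LubinTate.isAdicComplete_maximalIdeal_mvPowerSeries (A := R) (n - 1)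
  have hu := FGLHom.isUnit_coeff_one_of_isIso hφ₀
  obtain ⟨φ, hφ⟩ := hGt.exists_isLift (α := (α : R →+* R)) hFt.isDeformation hu hα
  refine ⟨φ, ⟨hφ.isIso hp.ne_zero hF hG hFt hGt hφ₀ hα, hφ.inducesOnResidueField,
    hφ.algebraMap_comp⟩, fun φ' ⟨_, hind, hC⟩ => ?_⟩
  exact hGt.isLift_unique hFt.isDeformation hp.ne_zero hF hG hu ⟨hind, hC⟩ hφ
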